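/- Let $n\ge 1$. For a convex body $K\subset\mathbb R^n$ (compact, convex, with nonempty interior) write $K\in C^2_+$ if $\partial K$ is of class $C^2$ with everywhere strictly positive Gauss curvature $\kappa_K$. Let $h_K(u)=\max_{x\in K}\langle x,u\rangle$ be the support function of $K$ and, for $K\in C^2_+$ and $u\in S^{n-1}$, let $f_K(u)=1/\kappa_K(x)$, where $x\in\partial K$ is the unique point at which $u$ is the outer unit normal. Let $\sigma$ be the surface area measure on $S^{n-1}$. For convex bodies $K_1,\dots,K_n\in C^2_+$ with centroid at the origin, the mixed $p$-affine surface area is $$as_p(K_1,\dots,K_n)=\int_{S^{n-1}}\Big[\prod_{i=1}^n h_{K_i}(u)^{1-p}f_{K_i}(u)\Big]^{\frac1{n+p}}\,d\sigma(u)\qquad(p\in\mathbb R,\ p\ne -n),$$ $$as_{\pm\infty}(K_1,\dots,K_n)=\int_{S^{n-1}}\prod_{i=1}^n\frac1{h_{K_i}(u)}\,d\sigma(u).$$ **Lemma.** Let $K_1,\dots,K_n\in C^2_+$ be convex bodies in $\mathbb R^n$ with centroid at the origin and let $T:\mathbb R^n\to\mathbb R^n$ be an invertible linear map. Then for all $p\in[-\infty,\infty]$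 with $p\neq -n$, $$as_p(TK_1,\dots,TK_n)=|\det T|^{\frac{n-p}{n+p}}\,as_p(K_1,\dots,K_n),$$ where the exponent $\frac{n-p}{n+p}$ is read as its limit $-1$ for $p=\pm\infty$. In particular, if $|\det T|=1$, then $as_p(TK_1,\dots,TK_n)=as_p(K_1,\dots,K_n)$ for all such $p$. -/

import Mathlib

open MeasureTheory Metric Filter Topology
open scoped RealInnerProductSpace

namespace MixedAffine

noncomputable section

/-- Euclidean space `ℝⁿ`. -/
abbrev E (n : ℕ) : Type := EuclideanSpace ℝ (Fin n)

/-- The support function `h_K(u) = sup_{x ∈ K} ⟨x, u⟩`. -/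
def supportFun {n : ℕ} (K : Set (E n)) (u : E n) : ℝ :=
  sSup ((fun x : E n => ⟪x, u⟫) '' K)

/-- `u` is an outer unit normal vector of the convex set `K` at its boundary point `x`. -/
def IsOuterUnitNormal {n : ℕ} (K : Set (E n)) (x u : E n) : Prop :=
  x ∈ frontier K ∧ ‖u‖ = 1 ∧ ∀ y ∈ K, ⟪y, u⟫ ≤ ⟪x, u⟫

open Classical in
/-- The Gauss map `N_K`: the outer unit normal at `x ∈ ∂K` (unique if `∂K` is smooth;
the value `0` is used where there is none). -/
def gaussMap {n : ℕ} (K : Set (E n)) (x : E n) : E n :=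
  if h : ∃ u, IsOuterUnitNormal K x u then h.choose else 0

/-- The determinant of the endomorphism `v ↦ P (A v)` of the hyperplane `u^⊥`, where `P` is the
orthogonal projection of `ℝⁿ` onto `u^⊥`. -/
def tangentDet {n : ℕ} (u : E n) (A : E n →L[ℝ] E n) : ℝ :=
  LinearMap.det
    (((ℝ ∙ u)ᗮ.orthogonalProjectionOnto ∘L A ∘L (ℝ ∙ u)ᗮ.subtypeL : (ℝ ∙ u)ᗮ →L[ℝ] (ℝ ∙ u)ᗮ) :
        (ℝ ∙ u)ᗮ →ₗ[ℝ] (ℝ ∙ u)ᗮ)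

/-- The Gauss curvature `κ_K(x)` at `x ∈ ∂K`: the determinant of the Weingarten map, i.e. of the
differential of the Gauss map `N_K : ∂K → S^{n-1}` at `x`, as an endomorphism of the tangent
hyperplane `N_K(x)^⊥`. (The derivative of `N_K` within `∂K` is determined on the tangent
hyperplane only, and it maps this hyperplane to itself; the projection in `tangentDet` just
restricts the codomain.) -/
def gaussCurvature {n : ℕ} (K : Set (E n)) (x : E n) : ℝ :=
  tangentDet (gaussMap K x) (fderivWithin ℝ (gaussMap K) (frontier K) x)

/-- `K` has `C²` boundary: near each boundary point, `K` is the sublevel set `{F ≤ 0}` of a `C²`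
function with nonvanishing differential. -/
def HasC2Boundary {n : ℕ} (K : Set (E n)) : Prop :=
  ∀ x ∈ frontier K, ∃ F : E n → ℝ,
    ContDiffAt ℝ 2 F x ∧ fderiv ℝ F x ≠ 0 ∧ ∀ᶠ y in 𝓝 x, (y ∈ K ↔ F y ≤ 0)

/-- The class `C²₊` of convex bodies (with nonempty interior) with `C²` boundary and everywhere
strictly positive Gauss curvature. -/
structure IsC2Plus {n : ℕ} (K : ConvexBody (E n)) : Prop where
  nonempty_interior : (interior (K : Set (E n))).Nonempty
  c2_boundary : HasC2Boundary (K : Set (E n))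
  curvature_pos : ∀ x ∈ frontier (K : Set (E n)), 0 < gaussCurvature (K : Set (E n)) x

/-- The centroid `|K|⁻¹ ∫_K x dx`. -/
def centroid {n : ℕ} (K : Set (E n)) : E n := ⨍ x in K, x

open Classical in
/-- The curvature function `f_K(u) = 1 / κ_K(x)`, where `x ∈ ∂K` is the point at which `u` is the
outer unit normal (it exists and is unique for `K` in `C²₊`). -/
def curvatureFun {n : ℕ} (K : Set (E n)) (u : E n) : ℝ :=
  if h : ∃ x, IsOuterUnitNormal K x u then (gaussCurvature K h.choose)⁻¹ else 0

/-- The mixed `p`-affine surface area of `K₁, …, Kₙ`, for real `p ≠ -n`: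
`∫_{S^{n-1}} [h_{K₁}(u)^{1-p} f_{K₁}(u) ⋯ h_{Kₙ}(u)^{1-p} f_{Kₙ}(u)]^{1/(n+p)} dσ(u)`. -/
def mixedAffineSurfaceArea {n : ℕ} (p : ℝ) (K : Fin n → Set (E n)) : ℝ :=
  ∫ u : sphere (0 : E n) 1,
    (∏ i, supportFun (K i) u ^ (1 - p) * curvatureFun (K i) u) ^ (1 / ((n : ℝ) + p))
    ∂(volume : Measure (E n)).toSphere

/-- The mixed `p`-affine surface area for `p = ∞`, which is also the one for `p = -∞`:
`∫_{S^{n-1}} 1 / (h_{K₁}(u) ⋯ h_{Kₙ}(u)) dσ(u)`. -/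
def mixedAffineSurfaceAreaInfty {n : ℕ} (K : Fin n → Set (E n)) : ℝ :=
  ∫ u : sphere (0 : E n) 1, ∏ i, 1 / supportFun (K i) u ∂(volume : Measure (E n)).toSphere

end

end MixedAffine

/-!
The support function and the curvature function transform under a linear automorphism `T` of `ℝⁿ`
by `h_{TK}(u) = ‖T* u‖ h_K(v)` and `f_{TK}(u) = (det T)² ‖T* u‖^{-(n+1)} f_K(v)`, where
`v = T* u / ‖T* u‖`. The second formula holds because the Gauss maps are related by
`N_{TK}(T x) = T⁻* N_K(x) / ‖T⁻* N_K(x)‖`: up to the projection onto the tangent hyperplane and the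
normalizing factor, the Weingarten map of `TK` is `T⁻* ∘ dN_K ∘ T⁻¹`, whose determinant on the
tangent hyperplane is computed by extending the operators to `ℝⁿ` by the identity on the normal
line. The integrand of `as_p(TK₁, …, TKₙ)` at `u` is therefore `|det T|^{2n/(n+p)} ‖T* u‖⁻ⁿ` times
that of `as_p(K₁, …, Kₙ)` at `v`. On the other hand `‖T* u‖⁻ⁿ dσ(u) = |det T|⁻¹ dσ(v)`, because the
volumes of corresponding star-shaped sets in `ℝⁿ` differ by the factor `|det T|`.
-/

open Module

namespace MixedAffine

noncomputable section

section LinearAlgebra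

theorem det_one_add_comp_comm {R U V : Type*} [CommRing R] [AddCommGroup U] [Module R U]
    [Module.Free R U] [Module.Finite R U] [AddCommGroup V] [Module R V] [Module.Free R V]
    [Module.Finite R V] (f : U →ₗ[R] V) (g : V →ₗ[R] U) :
    LinearMap.det (1 + f ∘ₗ g) = LinearMap.det (1 + g ∘ₗ f) := by
  classical
  let bU := Module.Free.chooseBasis R U
  let bV := Module.Free.chooseBasis R V
  rw [← LinearMap.det_toMatrix bV, ← LinearMap.det_toMatrix bU, map_add, map_add,
    LinearMap.toMatrix_comp bV bU bV, LinearMap.toMatrix_comp bU bV bU, LinearMap.toMatrix_one,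
    LinearMap.toMatrix_one, Matrix.det_one_add_mul_comm]

variable {𝕜 V : Type*} [RCLike 𝕜] [NormedAddCommGroup V] [InnerProductSpace 𝕜 V]

theorem det_adjoint [FiniteDimensional 𝕜 V] (f : V →ₗ[𝕜] V) :
    LinearMap.det f.adjoint = star (LinearMap.det f) := by
  let b := stdOrthonormalBasis 𝕜 V
  rw [← LinearMap.det_toMatrix b.toBasis, ← LinearMap.det_toMatrix b.toBasis,
    LinearMap.toMatrix_adjoint, Matrix.det_conjTranspose]

theorem det_compression [FiniteDimensional 𝕜 V] (U : Submodule 𝕜 V) (A : V →ₗ[𝕜] V) :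
    LinearMap.det (U.orthogonalProjectionOnto.toLinearMap ∘ₗ A ∘ₗ U.subtype) =
      LinearMap.det (A ∘ₗ U.starProjection.toLinearMap + Uᗮ.starProjection.toLinearMap) := by
  let P : V →ₗ[𝕜] U := U.orthogonalProjectionOnto.toLinearMap
  have extension_eq : A ∘ₗ U.starProjection.toLinearMap + Uᗮ.starProjection.toLinearMap =
      1 + ((A - 1) ∘ₗ U.subtype) ∘ₗ P := by
    ext v
    simp only [P, LinearMap.add_apply, LinearMap.comp_apply, LinearMap.sub_apply,
      Module.End.one_apply, ContinuousLinearMap.coe_coe, Submodule.subtype_apply,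
      Submodule.coe_orthogonalProjectionOnto_apply, Submodule.starProjection_orthogonal_val]
    abel
  have compression_eq : 1 + P ∘ₗ ((A - 1) ∘ₗ U.subtype) = P ∘ₗ A ∘ₗ U.subtype := by
    ext v
    simp [P]
  rw [extension_eq, det_one_add_comp_comm, compression_eq]

/-- The Hilbert space adjoint of a continuous linear equivalence, as a continuous linear
equivalence. -/
def adjointEquiv [CompleteSpace V] (T : V ≃L[𝕜] V) : V ≃L[𝕜] V :=
  ContinuousLinearEquiv.equivOfInverse' (T : V →L[𝕜] V).adjoint (T.symm : V →L[𝕜] V).adjoint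
    (by rw [← ContinuousLinearMap.adjoint_comp]; simp [ContinuousLinearMap.adjoint_id])
    (by rw [← ContinuousLinearMap.adjoint_comp]; simp [ContinuousLinearMap.adjoint_id])

theorem inner_adjointEquiv_left [CompleteSpace V] (T : V ≃L[𝕜] V) (v w : V) :
    inner 𝕜 (adjointEquiv T v) w = inner 𝕜 v (T w) :=
  ContinuousLinearMap.adjoint_inner_left _ _ _

theorem symm_apply_mem_orthogonal_adjointEquiv [CompleteSpace V] (T : V ≃L[𝕜] V) {u v : V}
    (hv : v ∈ (𝕜 ∙ u)ᗮ) :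
    T.symm v ∈ (𝕜 ∙ adjointEquiv T u)ᗮ := by
  rw [Submodule.mem_orthogonal_singleton_iff_inner_right] at hv ⊢
  rw [inner_adjointEquiv_left, T.apply_symm_apply, hv]

theorem det_adjointEquiv [FiniteDimensional 𝕜 V] [CompleteSpace V] (T : V ≃L[𝕜] V) :
    LinearMap.det (adjointEquiv T : V →ₗ[𝕜] V) = star (LinearMap.det (T : V →ₗ[𝕜] V)) :=
  det_adjoint (T : V →ₗ[𝕜] V)

end LinearAlgebra

section TangentDet

variable {n : ℕ} {u : E n}

theorem tangentDet_eq_det (u : E n) (A : E n →L[ℝ] E n) :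
    tangentDet u A = LinearMap.det
      (A.toLinearMap ∘ₗ (ℝ ∙ u)ᗮ.starProjection.toLinearMap +
        (ℝ ∙ u).starProjection.toLinearMap) := by
  have h := det_compression (ℝ ∙ u)ᗮ A.toLinearMap
  simp only [Submodule.orthogonal_orthogonal] at h
  exact h

theorem tangentDet_eq_of_span_eq {u v : E n} (h : ℝ ∙ u = ℝ ∙ v) (A : E n →L[ℝ] E n) :
    tangentDet u A = tangentDet v A := by
  simp only [tangentDet_eq_det, h]

theorem tangentDet_congr {A B : E n →L[ℝ] E n} (h : Set.EqOn A B (ℝ ∙ u)ᗮ) :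
    tangentDet u A = tangentDet u B := by
  unfold tangentDet
  congr 2
  ext1 v
  exact congrArg (ℝ ∙ u)ᗮ.orthogonalProjectionOnto (h v.2)

theorem tangentDet_eq_zero {v : E n} {A : E n →L[ℝ] E n} (hv : v ∈ (ℝ ∙ u)ᗮ) (hv0 : v ≠ 0)
    (hA : A v = 0) : tangentDet u A = 0 := by
  refine LinearMap.det_eq_zero_iff_ker_ne_bot.2 fun hker => hv0 ?_
  have hmem : (⟨v, hv⟩ : (ℝ ∙ u)ᗮ) ∈ LinearMap.ker (((ℝ ∙ u)ᗮ.orthogonalProjectionOnto ∘L A ∘L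
      (ℝ ∙ u)ᗮ.subtypeL : (ℝ ∙ u)ᗮ →L[ℝ] (ℝ ∙ u)ᗮ) : (ℝ ∙ u)ᗮ →ₗ[ℝ] (ℝ ∙ u)ᗮ) := by
    simp [hA]
  rw [hker] at hmem
  exact congrArg Subtype.val ((Submodule.mem_bot ℝ).1 hmem)

theorem tangentDet_smul (hu : u ≠ 0) (c : ℝ) (A : E n →L[ℝ] E n) :
    tangentDet u (c • A) = c ^ (n - 1) * tangentDet u A := by
  have hrank : finrank ℝ (ℝ ∙ u)ᗮ = n - 1 := by
    have h := (ℝ ∙ u).finrank_add_finrank_orthogonal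
    rw [finrank_span_singleton hu, finrank_euclideanSpace_fin] at h
    omega
  unfold tangentDet
  rw [← hrank, ← LinearMap.det_smul]
  congr 1
  ext1 v
  simp

theorem tangentDet_starProjection_comp (u : E n) (A : E n →L[ℝ] E n) :
    tangentDet u ((ℝ ∙ u)ᗮ.starProjection ∘L A) = tangentDet u A := by
  unfold tangentDet
  congr 2
  ext1 v
  simp

/-- The linear map with value `T (T* u)` at the unit vector `u` and equal to the identity on
`u^⊥`. Followed by `T⁻¹` it maps the splitting `ℝ u ⊕ u^⊥` to the splitting along `T* u`. -/
def splittingMap (T : E n ≃L[ℝ] E n) (u : E n) : E n →ₗ[ℝ] E n :=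
  LinearMap.transvection (innerₗ (E n) u) (T (adjointEquiv T u) - u)

theorem det_splittingMap (hu : ‖u‖ = 1) (T : E n ≃L[ℝ] E n) :
    LinearMap.det (splittingMap T u) = ‖adjointEquiv T u‖ ^ 2 := by
  have inner_eq : ⟪u, T (adjointEquiv T u)⟫ = ‖adjointEquiv T u‖ ^ 2 := by
    rw [← inner_adjointEquiv_left, real_inner_self_eq_norm_sq]
  simp [splittingMap, LinearMap.transvection.det, inner_sub_right, inner_eq, hu]

theorem symm_splittingMap (hu : ‖u‖ = 1) (T : E n ≃L[ℝ] E n) (v : E n) :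
    T.symm (splittingMap T u v) =
      ⟪u, v⟫ • adjointEquiv T u + T.symm ((ℝ ∙ u)ᗮ.starProjection v) := by
  simp only [splittingMap, LinearMap.transvection.apply, innerₗ_apply_apply, smul_sub,
    Submodule.starProjection_orthogonal_val, Submodule.starProjection_unit_singleton ℝ hu,
    map_add, map_sub, map_smul, T.symm_apply_apply]
  abel

theorem conj_splittingMap (hu : ‖u‖ = 1) (T : E n ≃L[ℝ] E n) (A : E n →L[ℝ] E n) :
    ((adjointEquiv T).symm ∘L A ∘L T.symm : E n →L[ℝ] E n).toLinearMap ∘ₗ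
        (ℝ ∙ u)ᗮ.starProjection.toLinearMap + (ℝ ∙ u).starProjection.toLinearMap =
      ((adjointEquiv T).symm : E n →ₗ[ℝ] E n) ∘ₗ
        (A.toLinearMap ∘ₗ (ℝ ∙ adjointEquiv T u)ᗮ.starProjection.toLinearMap +
          (ℝ ∙ adjointEquiv T u).starProjection.toLinearMap) ∘ₗ
        (T.symm : E n →ₗ[ℝ] E n) ∘ₗ splittingMap T u := by
  set w := adjointEquiv T u with hw
  ext1 v
  have symm_mem : T.symm ((ℝ ∙ u)ᗮ.starProjection v) ∈ (ℝ ∙ w)ᗮ :=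
    symm_apply_mem_orthogonal_adjointEquiv T (Submodule.starProjection_apply_mem _ v)
  have proj_w : (ℝ ∙ w).starProjection (T.symm (splittingMap T u v)) = ⟪u, v⟫ • w := by
    rw [symm_splittingMap hu, map_add, (Submodule.starProjection_apply_eq_zero_iff _).2 symm_mem,
      add_zero, Submodule.starProjection_eq_self_iff.2
        (Submodule.smul_mem _ _ (Submodule.mem_span_singleton_self w))]
  have proj_w_orthogonal : (ℝ ∙ w)ᗮ.starProjection (T.symm (splittingMap T u v)) =
      T.symm ((ℝ ∙ u)ᗮ.starProjection v) := by
    rw [Submodule.starProjection_orthogonal_val, proj_w, symm_splittingMap hu,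
      add_sub_cancel_left]
  simp only [LinearMap.add_apply, LinearMap.comp_apply, ContinuousLinearMap.coe_coe,
    ContinuousLinearMap.comp_apply, ContinuousLinearEquiv.coe_coe, LinearEquiv.coe_coe,
    ContinuousLinearEquiv.coe_toLinearEquiv, proj_w, proj_w_orthogonal, map_add, map_smul,
    Submodule.starProjection_unit_singleton ℝ hu v]
  rw [hw, ContinuousLinearEquiv.symm_apply_apply]

theorem tangentDet_conj (hu : ‖u‖ = 1) (T : E n ≃L[ℝ] E n) (A : E n →L[ℝ] E n) :
    tangentDet u ((adjointEquiv T).symm ∘L A ∘L T.symm) =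
      ‖adjointEquiv T u‖ ^ 2 / LinearMap.det (T : E n →ₗ[ℝ] E n) ^ 2 *
        tangentDet (adjointEquiv T u) A := by
  have det_symm (S : E n ≃L[ℝ] E n) :
      LinearMap.det (S.symm : E n →ₗ[ℝ] E n) = (LinearMap.det (S : E n →ₗ[ℝ] E n))⁻¹ :=
    S.det_coe_symm
  rw [tangentDet_eq_det, tangentDet_eq_det, conj_splittingMap hu, LinearMap.det_comp,
    LinearMap.det_comp, LinearMap.det_comp, det_splittingMap hu, det_symm, det_symm,
    det_adjointEquiv, star_trivial]
  ring

end TangentDet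

section Normalize

theorem normalize_map_normalize {V W : Type*} [NormedAddCommGroup V] [NormedSpace ℝ V]
    [NormedAddCommGroup W] [NormedSpace ℝ W] (L : V →ₗ[ℝ] W) (v : V) :
    NormedSpace.normalize (L (NormedSpace.normalize v)) = NormedSpace.normalize (L v) := by
  rcases eq_or_ne v 0 with rfl | hv
  · simp
  · rw [show NormedSpace.normalize v = ‖v‖⁻¹ • v from rfl, map_smul,
      NormedSpace.normalize_smul_of_pos (inv_pos.2 (norm_pos_iff.2 hv))]

theorem span_singleton_normalize {V : Type*} [NormedAddCommGroup V] [NormedSpace ℝ V] (v : V) :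
    ℝ ∙ NormedSpace.normalize v = ℝ ∙ v := by
  rcases eq_or_ne v 0 with rfl | hv
  · simp
  · exact Submodule.span_singleton_smul_eq (inv_ne_zero (norm_ne_zero_iff.2 hv)).isUnit v

theorem hasFDerivAt_normalize {V : Type*} [NormedAddCommGroup V] [InnerProductSpace ℝ V] {x : V}
    (hx : x ≠ 0) :
    HasFDerivAt NormedSpace.normalize (‖x‖⁻¹ • (ℝ ∙ x)ᗮ.starProjection) x := by
  have hnorm : ‖x‖ ≠ 0 := norm_ne_zero_iff.2 hx
  have hasFDerivAt_norm : HasFDerivAt (fun y : V => ‖y‖) (‖x‖⁻¹ • innerSL ℝ x) x := by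
    have h := (hasStrictFDerivAt_norm_sq x).hasFDerivAt.sqrt (pow_ne_zero 2 hnorm)
    simp only [Real.sqrt_sq (norm_nonneg _)] at h
    convert h using 1
    ext v
    simp only [smul_apply, coe_innerSL_apply, smul_eq_mul, one_div, mul_inv_rev, nsmul_eq_mul,
      Nat.cast_ofNat]
    field_simp
  have h := ((hasDerivAt_inv hnorm).comp_hasFDerivAt x hasFDerivAt_norm).smul (hasFDerivAt_id x)
  refine h.congr_fderiv ?_
  ext1 v
  simp only [Function.comp_apply, neg_smul, id_eq, add_apply, smul_apply,
    ContinuousLinearMap.id_apply, ContinuousLinearMap.smulRight_apply, neg_apply,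
    coe_innerSL_apply, smul_eq_mul, Submodule.starProjection_orthogonal_val,
    Submodule.starProjection_singleton, Real.ringHom_apply]
  module

end Normalize

section DefiningFunction

theorem ker_subset_tangentConeAt_fiber {𝕜 V W : Type*} [NontriviallyNormedField 𝕜]
    [CompleteSpace 𝕜] [NormedAddCommGroup V] [NormedSpace 𝕜 V] [CompleteSpace V]
    [NormedAddCommGroup W] [NormedSpace 𝕜 W] [FiniteDimensional 𝕜 W] {f : V → W} {f' : V →L[𝕜] W}
    {x : V} (hf : HasStrictFDerivAt f f' x) (hf' : f'.range = ⊤) :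
    (f'.ker : Set V) ⊆ tangentConeAt 𝕜 {y | f y = f x} x := by
  let φ := hf.implicitFunction f f' hf' (f x)
  have fiber_mem : {z | f (φ z) = f x} ∈ 𝓝 (0 : f'.ker) :=
    (hf.map_implicitFunction_eq hf').curry_nhds.self_of_nhds
  intro v hv
  have hφ := (hf.to_implicitFunction hf').hasFDerivAt.hasFDerivWithinAt
    (s := {z | f (φ z) = f x})
  have mem_cone : (⟨v, hv⟩ : f'.ker) ∈ tangentConeAt 𝕜 {z | f (φ z) = f x} 0 := by
    rw [tangentConeAt_of_mem_nhds fiber_mem]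
    exact Set.mem_univ _
  have hmem := hφ.mapsTo_tangent_cone mem_cone
  rw [hf.implicitFunction_apply_image hf'] at hmem
  exact tangentConeAt_mono (Set.image_subset_iff.2 fun z hz => hz) hmem

/-- `F` is a `C²` defining function of the set `K` near the point `x`: it has nonzero differential
at `x`, and `K` is the sublevel set `{F ≤ 0}` near `x`. Thus `HasC2Boundary K` asks for such a
function at each boundary point of `K`. -/
structure IsDefiningFunctionAt {V : Type*} [NormedAddCommGroup V] [NormedSpace ℝ V] (K : Set V)
    (F : V → ℝ) (x : V) : Prop where
  contDiffAt : ContDiffAt ℝ 2 F x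
  fderiv_ne_zero : fderiv ℝ F x ≠ 0
  eventually_mem_iff : ∀ᶠ y in 𝓝 x, (y ∈ K ↔ F y ≤ 0)

namespace IsDefiningFunctionAt

variable {V : Type*} [NormedAddCommGroup V] [NormedSpace ℝ V] {K : Set V} {F : V → ℝ} {x : V}

theorem eventually (h : IsDefiningFunctionAt K F x) :
    ∀ᶠ y in 𝓝 x, IsDefiningFunctionAt K F y := by
  filter_upwards [h.contDiffAt.eventually (by simp),
    (h.contDiffAt.continuousAt_fderiv two_ne_zero).eventually_ne h.fderiv_ne_zero,
    eventually_eventually_nhds.2 h.eventually_mem_iff] with y h₁ h₂ h₃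
  exact ⟨h₁, h₂, h₃⟩

theorem apply_eq_zero (h : IsDefiningFunctionAt K F x) (hx : x ∈ frontier K) : F x = 0 := by
  have hF := h.contDiffAt.continuousAt
  refine le_antisymm (not_lt.1 fun hpos => ?_) (not_lt.1 fun hneg => hx.2 ?_)
  · obtain ⟨y, hyK, hy, hy_pos⟩ := ((mem_closure_iff_frequently.1 hx.1).and_eventually
      (h.eventually_mem_iff.and (hF.eventually_const_lt hpos))).exists
    exact hy_pos.not_ge (hy.1 hyK)
  · rw [mem_interior_iff_mem_nhds]
    filter_upwards [h.eventually_mem_iff, hF.eventually_lt_const hneg] with y hy hy_neg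
    exact hy.2 hy_neg.le

theorem mem_frontier (h : IsDefiningFunctionAt K F x) (hx : F x = 0) : x ∈ frontier K := by
  refine ⟨subset_closure (h.eventually_mem_iff.self_of_nhds.2 hx.le), fun hint => ?_⟩
  have isLocalMax : IsLocalMax F x := by
    filter_upwards [h.eventually_mem_iff, mem_interior_iff_mem_nhds.1 hint] with y hy hyK
    exact (hy.1 hyK).trans hx.ge
  exact h.fderiv_ne_zero isLocalMax.fderiv_eq_zero

theorem mem (h : IsDefiningFunctionAt K F x) (hx : x ∈ frontier K) : x ∈ K :=
  h.eventually_mem_iff.self_of_nhds.2 (h.apply_eq_zero hx).le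

theorem ker_subset_tangentConeAt [CompleteSpace V] (h : IsDefiningFunctionAt K F x)
    (hx : x ∈ frontier K) : ((fderiv ℝ F x).ker : Set V) ⊆ tangentConeAt ℝ (frontier K) x := by
  have surjective : (fderiv ℝ F x).range = ⊤ :=
    LinearMap.range_eq_top.2 (LinearMap.surjective
      fun h0 => h.fderiv_ne_zero (ContinuousLinearMap.coe_injective h0))
  refine (ker_subset_tangentConeAt_fiber (h.contDiffAt.hasStrictFDerivAt two_ne_zero)
    surjective).trans (tangentConeAt_mono_nhds ?_)
  refine nhdsWithin_le_iff.2 (mem_nhdsWithin_iff_eventually.2 ?_)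
  filter_upwards [h.eventually] with y hy hFy
  exact hy.mem_frontier (hFy.trans (h.apply_eq_zero hx))

theorem eventually_add_smul_mem (h : IsDefiningFunctionAt K F x) (hx : x ∈ frontier K) {v : V}
    (hv : fderiv ℝ F x v < 0) : ∀ᶠ t : ℝ in 𝓝[>] 0, x + t • v ∈ K := by
  have slope_tendsto := ((h.contDiffAt.differentiableAt two_ne_zero).hasFDerivAt.hasLineDerivAt
    v).tendsto_slope_zero_right
  have line_tendsto : Tendsto (fun t : ℝ => x + t • v) (𝓝[>] 0) (𝓝 x) := by
    refine Tendsto.mono_left ?_ nhdsWithin_le_nhds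
    exact Continuous.tendsto' (by fun_prop) _ _ (by simp)
  filter_upwards [slope_tendsto.eventually_lt_const hv, line_tendsto.eventually
    h.eventually_mem_iff, self_mem_nhdsWithin] with t hslope hmem (ht : 0 < t)
  rw [h.apply_eq_zero hx, sub_zero, smul_eq_mul] at hslope
  exact hmem.2 (neg_of_mul_neg_right hslope (inv_pos.2 ht).le).le

theorem fderiv_sub_nonpos (h : IsDefiningFunctionAt K F x) (hx : x ∈ frontier K)
    (hK : Convex ℝ K) {y : V} (hy : y ∈ K) : fderiv ℝ F x (y - x) ≤ 0 := by
  have isLocalMaxOn : IsLocalMaxOn F K x := by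
    filter_upwards [nhdsWithin_le_nhds h.eventually_mem_iff, self_mem_nhdsWithin] with z hz hzK
    exact (hz.1 hzK).trans (h.apply_eq_zero hx).ge
  exact isLocalMaxOn.hasFDerivWithinAt_nonpos
    (h.contDiffAt.differentiableAt two_ne_zero).hasFDerivAt.hasFDerivWithinAt
    (sub_mem_posTangentConeAt_of_segment_subset (hK.segment_subset (h.mem hx) hy))

end IsDefiningFunctionAt

end DefiningFunction

section GaussMap

theorem isOuterUnitNormal_gaussMap {n : ℕ} {K : Set (E n)} {x : E n}
    (h : ∃ u, IsOuterUnitNormal K x u) : IsOuterUnitNormal K x (gaussMap K x) := by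
  rw [gaussMap, dif_pos h]
  exact h.choose_spec

theorem isOuterUnitNormal_of_forall_inner_le {n : ℕ} {K : Set (E n)} {x u : E n} (hx : x ∈ K)
    (hu : ‖u‖ = 1) (h : ∀ y ∈ K, ⟪y, u⟫ ≤ ⟪x, u⟫) : IsOuterUnitNormal K x u := by
  refine ⟨⟨subset_closure hx, fun hint => ?_⟩, hu, h⟩
  have isLocalMax : IsLocalMax (innerSL ℝ u) x := by
    filter_upwards [mem_interior_iff_mem_nhds.1 hint] with y hy
    simpa only [innerSL_apply_apply, real_inner_comm u] using h y hy
  have inner_eq_zero :=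
    DFunLike.congr_fun (isLocalMax.hasFDerivAt_eq_zero (innerSL ℝ u).hasFDerivAt) u
  simp [hu] at inner_eq_zero

namespace IsDefiningFunctionAt

variable {n : ℕ} {K : Set (E n)} {F : E n → ℝ} {x : E n}

theorem gradient_ne_zero (h : IsDefiningFunctionAt K F x) : gradient F x ≠ 0 := fun h0 =>
  h.fderiv_ne_zero (by rw [← toDual_gradient, h0, map_zero])

theorem isOuterUnitNormal_iff (h : IsDefiningFunctionAt K F x) (hK : Convex ℝ K)
    (hx : x ∈ frontier K) {u : E n} :
    IsOuterUnitNormal K x u ↔ u = NormedSpace.normalize (gradient F x) := by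
  set ν := NormedSpace.normalize (gradient F x) with hν
  have norm_ν : ‖ν‖ = 1 := NormedSpace.norm_normalize h.gradient_ne_zero
  have fderiv_apply (v : E n) : fderiv ℝ F x v = ‖gradient F x‖ * ⟪ν, v⟫ := by
    rw [← inner_gradient_left, ← real_inner_smul_left, hν, NormedSpace.norm_smul_normalize]
  have norm_pos : 0 < ‖gradient F x‖ := norm_pos_iff.2 h.gradient_ne_zero
  constructor
  · -- Otherwise `u - ν` points into `K`, although it makes an acute angle with the normal `u`.
    rintro ⟨-, norm_u, hu⟩
    by_contra hne
    have inner_lt_one : ⟪ν, u⟫ < 1 :=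
      (inner_lt_one_iff_real_of_norm_eq_one norm_ν norm_u).2 (Ne.symm hne)
    have fderiv_neg : fderiv ℝ F x (u - ν) < 0 := by
      rw [fderiv_apply, inner_sub_right, real_inner_self_eq_norm_sq, norm_ν]
      nlinarith
    obtain ⟨t, hmem, ht : 0 < t⟩ :=
      ((h.eventually_add_smul_mem hx fderiv_neg).and self_mem_nhdsWithin).exists
    have hle := hu _ hmem
    rw [inner_add_left, real_inner_smul_left, inner_sub_left, real_inner_self_eq_norm_sq,
      norm_u] at hle
    nlinarith
  · rintro rfl
    refine ⟨hx, norm_ν, fun y hy => ?_⟩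
    have hle := h.fderiv_sub_nonpos hx hK hy
    rw [fderiv_apply, real_inner_comm, inner_sub_left] at hle
    nlinarith

theorem gaussMap_eq (h : IsDefiningFunctionAt K F x) (hK : Convex ℝ K) (hx : x ∈ frontier K) :
    gaussMap K x = NormedSpace.normalize (gradient F x) :=
  (h.isOuterUnitNormal_iff hK hx).1
    (isOuterUnitNormal_gaussMap ⟨_, (h.isOuterUnitNormal_iff hK hx).2 rfl⟩)

theorem differentiableWithinAt_gaussMap (h : IsDefiningFunctionAt K F x) (hK : Convex ℝ K)
    (hx : x ∈ frontier K) : DifferentiableWithinAt ℝ (gaussMap K) (frontier K) x := by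
  have differentiableAt_gradient : DifferentiableAt ℝ (gradient F) x :=
    (InnerProductSpace.toDual ℝ (E n)).symm.toContinuousLinearEquiv.differentiableAt.comp x
      ((h.contDiffAt.fderiv_right (m := 1) (by norm_num)).differentiableAt one_ne_zero)
  have eventuallyEq :
      gaussMap K =ᶠ[𝓝[frontier K] x] NormedSpace.normalize ∘ gradient F := by
    filter_upwards [nhdsWithin_le_nhds h.eventually, self_mem_nhdsWithin] with y hy hyK
    exact hy.gaussMap_eq hK hyK
  exact ((hasFDerivAt_normalize h.gradient_ne_zero).differentiableAt.comp x
    differentiableAt_gradient).differentiableWithinAt.congr_of_eventuallyEq eventuallyEq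
      (h.gaussMap_eq hK hx)

end IsDefiningFunctionAt

theorem IsDefiningFunctionAt.image {V W : Type*} [NormedAddCommGroup V] [NormedSpace ℝ V]
    [NormedAddCommGroup W] [NormedSpace ℝ W] {K : Set V} {F : V → ℝ} {x : V}
    (h : IsDefiningFunctionAt K F x) (T : V ≃L[ℝ] W) :
    IsDefiningFunctionAt (T '' K) (F ∘ T.symm) (T x) where
  contDiffAt := ContDiffAt.comp _ (by rw [T.symm_apply_apply]; exact h.contDiffAt)
    T.symm.contDiff.contDiffAt
  fderiv_ne_zero h0 := h.fderiv_ne_zero <| by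
    ext v
    simpa [ContinuousLinearEquiv.comp_right_fderiv] using DFunLike.congr_fun h0 (T v)
  eventually_mem_iff := by
    have symm_tendsto : Tendsto T.symm (𝓝 (T x)) (𝓝 x) :=
      T.symm.continuous.tendsto' _ _ (T.symm_apply_apply x)
    filter_upwards [symm_tendsto.eventually h.eventually_mem_iff] with y hy
    rw [T.image_eq_preimage_symm]
    exact hy

theorem frontier_image {V W : Type*} [NormedAddCommGroup V] [NormedSpace ℝ V]
    [NormedAddCommGroup W] [NormedSpace ℝ W] (T : V ≃L[ℝ] W) (K : Set V) :
    frontier (T '' K) = T '' frontier K :=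
  (T.toHomeomorph.image_frontier K).symm

namespace HasC2Boundary

variable {n : ℕ} {K : Set (E n)} {x : E n}

theorem exists_isDefiningFunctionAt (h : HasC2Boundary K) (hx : x ∈ frontier K) :
    ∃ F, IsDefiningFunctionAt K F x :=
  let ⟨F, contDiffAt, fderiv_ne_zero, eventually_mem_iff⟩ := h x hx
  ⟨F, contDiffAt, fderiv_ne_zero, eventually_mem_iff⟩

theorem image (h : HasC2Boundary K) (T : E n ≃L[ℝ] E n) : HasC2Boundary (T '' K) := by
  intro y hy
  rw [frontier_image] at hy
  obtain ⟨x, hx, rfl⟩ := hy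
  obtain ⟨F, hF⟩ := h.exists_isDefiningFunctionAt hx
  exact ⟨_, (hF.image T).contDiffAt, (hF.image T).fderiv_ne_zero, (hF.image T).eventually_mem_iff⟩

theorem isOuterUnitNormal_iff (h : HasC2Boundary K) (hK : Convex ℝ K) (hx : x ∈ frontier K)
    {u : E n} : IsOuterUnitNormal K x u ↔ u = gaussMap K x := by
  obtain ⟨F, hF⟩ := h.exists_isDefiningFunctionAt hx
  rw [hF.gaussMap_eq hK hx, hF.isOuterUnitNormal_iff hK hx]

theorem isOuterUnitNormal_gaussMap (h : HasC2Boundary K) (hK : Convex ℝ K)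
    (hx : x ∈ frontier K) : IsOuterUnitNormal K x (gaussMap K x) :=
  (h.isOuterUnitNormal_iff hK hx).2 rfl

theorem hasFDerivWithinAt_gaussMap (h : HasC2Boundary K) (hK : Convex ℝ K)
    (hx : x ∈ frontier K) : HasFDerivWithinAt (gaussMap K)
      (fderivWithin ℝ (gaussMap K) (frontier K) x) (frontier K) x := by
  obtain ⟨F, hF⟩ := h.exists_isDefiningFunctionAt hx
  exact (hF.differentiableWithinAt_gaussMap hK hx).hasFDerivWithinAt

theorem orthogonal_gaussMap_subset_tangentConeAt (h : HasC2Boundary K) (hK : Convex ℝ K)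
    (hx : x ∈ frontier K) :
    ((ℝ ∙ gaussMap K x)ᗮ : Set (E n)) ⊆ tangentConeAt ℝ (frontier K) x := by
  obtain ⟨F, hF⟩ := h.exists_isDefiningFunctionAt hx
  rw [hF.gaussMap_eq hK hx, span_singleton_normalize]
  refine Set.Subset.trans (fun v hv => ?_) (hF.ker_subset_tangentConeAt hx)
  exact inner_gradient_left.symm.trans
    (Submodule.mem_orthogonal_singleton_iff_inner_right.1 hv)

end HasC2Boundary

end GaussMap

section CurvatureFunction

theorem fderivWithin_sub_eq_zero_of_eqOn_segment {V W : Type*} [NormedAddCommGroup V]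
    [NormedSpace ℝ V] [NormedAddCommGroup W] [NormedSpace ℝ W] {f : V → W} {s : Set V} {x y : V}
    {c : W} (hs : segment ℝ x y ⊆ s) (hf : ∀ z ∈ segment ℝ x y, f z = c) :
    fderivWithin ℝ f s x (y - x) = 0 := by
  by_cases h : DifferentiableWithinAt ℝ f s x
  · have const : HasFDerivWithinAt f (0 : V →L[ℝ] W) (segment ℝ x y) x :=
      (hasFDerivWithinAt_const c x _).congr hf (hf x (left_mem_segment ℝ x y))
    exact (h.hasFDerivWithinAt.mono hs).unique_on const
      (mem_tangentConeAt_of_segment_subset subset_rfl)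
  · rw [fderivWithin_zero_of_not_differentiableWithinAt h, zero_apply]

theorem exists_isOuterUnitNormal {n : ℕ} (K : ConvexBody (E n)) {u : E n} (hu : ‖u‖ = 1) :
    ∃ x, IsOuterUnitNormal (K : Set (E n)) x u := by
  obtain ⟨x, hx, hmax⟩ := K.isCompact.exists_isMaxOn K.nonempty
    (f := fun x : E n => ⟪x, u⟫) (by fun_prop)
  exact ⟨x, isOuterUnitNormal_of_forall_inner_le hx hu hmax⟩

theorem isOuterUnitNormal_of_mem_segment {n : ℕ} {K : Set (E n)} (hK : Convex ℝ K)
    (hclosed : IsClosed K) {x y z u : E n} (hx : IsOuterUnitNormal K x u)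
    (hy : IsOuterUnitNormal K y u) (hz : z ∈ segment ℝ x y) : IsOuterUnitNormal K z u := by
  have hxK := hclosed.frontier_subset hx.1
  have hyK := hclosed.frontier_subset hy.1
  refine isOuterUnitNormal_of_forall_inner_le (hK.segment_subset hxK hyK hz) hx.2.1
    fun w hw => ?_
  obtain ⟨a, b, -, -, hab, rfl⟩ := hz
  rw [inner_add_left, real_inner_smul_left, real_inner_smul_left,
    le_antisymm (hx.2.2 y hyK) (hy.2.2 x hxK), ← add_mul, hab, one_mul]
  exact hx.2.2 w hw

namespace IsC2Plus

variable {n : ℕ} {K : ConvexBody (E n)} {x y u : E n}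

theorem eq_of_isOuterUnitNormal (hK : IsC2Plus K) (hx : IsOuterUnitNormal (K : Set (E n)) x u)
    (hy : IsOuterUnitNormal (K : Set (E n)) y u) : x = y := by
  by_contra hne
  have normal_of_mem_segment {z : E n} (hz : z ∈ segment ℝ x y) :
      IsOuterUnitNormal (K : Set (E n)) z u :=
    isOuterUnitNormal_of_mem_segment K.convex K.isClosed hx hy hz
  have gaussMap_eq {z : E n} (hz : z ∈ segment ℝ x y) : gaussMap (K : Set (E n)) z = u :=
    ((hK.c2_boundary.isOuterUnitNormal_iff K.convex (normal_of_mem_segment hz).1).1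
      (normal_of_mem_segment hz)).symm
  have fderivWithin_eq_zero :
      fderivWithin ℝ (gaussMap (K : Set (E n))) (frontier K) x (y - x) = 0 :=
    fderivWithin_sub_eq_zero_of_eqOn_segment (fun _ hz => (normal_of_mem_segment hz).1)
      (fun _ hz => gaussMap_eq hz)
  have sub_mem_orthogonal : y - x ∈ (ℝ ∙ u)ᗮ := by
    rw [Submodule.mem_orthogonal_singleton_iff_inner_left, inner_sub_left, sub_eq_zero]
    exact le_antisymm (hx.2.2 y (K.isClosed.frontier_subset hy.1))
      (hy.2.2 x (K.isClosed.frontier_subset hx.1))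
  refine (hK.curvature_pos x hx.1).ne' ?_
  rw [gaussCurvature, gaussMap_eq (left_mem_segment ℝ x y)]
  exact tangentDet_eq_zero sub_mem_orthogonal (sub_ne_zero.2 (Ne.symm hne)) fderivWithin_eq_zero

theorem curvatureFun_eq (hK : IsC2Plus K) (hx : IsOuterUnitNormal (K : Set (E n)) x u) :
    curvatureFun (K : Set (E n)) u = (gaussCurvature (K : Set (E n)) x)⁻¹ := by
  have h : ∃ x, IsOuterUnitNormal (K : Set (E n)) x u := ⟨x, hx⟩
  rw [curvatureFun, dif_pos h, hK.eq_of_isOuterUnitNormal h.choose_spec hx]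

theorem curvatureFun_nonneg (hK : IsC2Plus K) (hu : ‖u‖ = 1) :
    0 ≤ curvatureFun (K : Set (E n)) u := by
  obtain ⟨x, hx⟩ := exists_isOuterUnitNormal K hu
  rw [hK.curvatureFun_eq hx]
  exact (inv_pos.2 (hK.curvature_pos x hx.1)).le

end IsC2Plus

end CurvatureFunction

section LinearImage

variable {n : ℕ}

theorem isOuterUnitNormal_image_iff (T : E n ≃L[ℝ] E n) (K : Set (E n)) (x : E n) {u : E n}
    (hu : ‖u‖ = 1) : IsOuterUnitNormal (T '' K) (T x) u ↔
      IsOuterUnitNormal K x (NormedSpace.normalize (adjointEquiv T u)) := by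
  have hu0 : u ≠ 0 := norm_ne_zero_iff.1 (hu ▸ one_ne_zero)
  have adjoint_ne_zero : adjointEquiv T u ≠ 0 :=
    (map_ne_zero_iff _ (adjointEquiv T).injective).2 hu0
  have inner_map (y : E n) : ⟪T y, u⟫ =
      ‖adjointEquiv T u‖ * ⟪y, NormedSpace.normalize (adjointEquiv T u)⟫ := by
    rw [← real_inner_smul_right, NormedSpace.norm_smul_normalize, real_inner_comm,
      ← inner_adjointEquiv_left, real_inner_comm]
  simp only [IsOuterUnitNormal, frontier_image, T.injective.mem_set_image, hu,
    NormedSpace.norm_normalize adjoint_ne_zero, Set.forall_mem_image, inner_map,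
    mul_le_mul_iff_right₀ (norm_pos_iff.2 adjoint_ne_zero)]

namespace HasC2Boundary

variable {K : Set (E n)} {x : E n}

theorem adjointEquiv_symm_gaussMap_ne_zero (h : HasC2Boundary K) (hK : Convex ℝ K)
    (hx : x ∈ frontier K) (T : E n ≃L[ℝ] E n) : (adjointEquiv T).symm (gaussMap K x) ≠ 0 :=
  (map_ne_zero_iff _ (adjointEquiv T).symm.injective).2
    (norm_ne_zero_iff.1 ((h.isOuterUnitNormal_gaussMap hK hx).2.1 ▸ one_ne_zero))

theorem gaussMap_image (h : HasC2Boundary K) (hK : Convex ℝ K) (hx : x ∈ frontier K)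
    (T : E n ≃L[ℝ] E n) : gaussMap (T '' K) (T x) =
      NormedSpace.normalize ((adjointEquiv T).symm (gaussMap K x)) := by
  have hν := h.isOuterUnitNormal_gaussMap hK hx
  have image_convex : Convex ℝ (T '' K) := hK.linear_image (T : E n →ₗ[ℝ] E n)
  have hTx : T x ∈ frontier (T '' K) := frontier_image T K ▸ Set.mem_image_of_mem T hx
  refine (((h.image T).isOuterUnitNormal_iff image_convex hTx).1 ?_).symm
  rw [isOuterUnitNormal_image_iff T K x (NormedSpace.norm_normalize
    (h.adjointEquiv_symm_gaussMap_ne_zero hK hx T))]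
  have normalize_eq : NormedSpace.normalize (adjointEquiv T
      (NormedSpace.normalize ((adjointEquiv T).symm (gaussMap K x)))) = gaussMap K x := by
    rw [← NormedSpace.normalize_eq_self_of_norm_eq_one hν.2.1]
    simpa using normalize_map_normalize (adjointEquiv T : E n →ₗ[ℝ] E n)
      ((adjointEquiv T).symm (NormedSpace.normalize (gaussMap K x)))
  rwa [normalize_eq]

theorem adjointEquiv_gaussMap_image (h : HasC2Boundary K) (hK : Convex ℝ K)
    (hx : x ∈ frontier K) (T : E n ≃L[ℝ] E n) : adjointEquiv T (gaussMap (T '' K) (T x)) =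
      ‖(adjointEquiv T).symm (gaussMap K x)‖⁻¹ • gaussMap K x := by
  rw [h.gaussMap_image hK hx T, NormedSpace.normalize, map_smul,
    ContinuousLinearEquiv.apply_symm_apply]

theorem norm_adjointEquiv_gaussMap_image (h : HasC2Boundary K) (hK : Convex ℝ K)
    (hx : x ∈ frontier K) (T : E n ≃L[ℝ] E n) : ‖adjointEquiv T (gaussMap (T '' K) (T x))‖ =
      ‖(adjointEquiv T).symm (gaussMap K x)‖⁻¹ := by
  rw [h.adjointEquiv_gaussMap_image hK hx T, norm_smul,
    (h.isOuterUnitNormal_gaussMap hK hx).2.1, mul_one, norm_inv, norm_norm]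

theorem hasFDerivWithinAt_gaussMap_image (h : HasC2Boundary K) (hK : Convex ℝ K)
    (hx : x ∈ frontier K) (T : E n ≃L[ℝ] E n) :
    HasFDerivWithinAt (gaussMap (T '' K))
      ((‖adjointEquiv T (gaussMap (T '' K) (T x))‖ •
        (ℝ ∙ gaussMap (T '' K) (T x))ᗮ.starProjection) ∘L
          (adjointEquiv T).symm ∘L fderivWithin ℝ (gaussMap K) (frontier K) x ∘L T.symm)
      (frontier (T '' K)) (T x) := by
  have mapsTo_symm : Set.MapsTo T.symm (frontier (T '' K)) (frontier K) := by
    rw [frontier_image]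
    rintro _ ⟨y, hy, rfl⟩
    rwa [T.symm_apply_apply]
  have eqOn : Set.EqOn (gaussMap (T '' K))
      (NormedSpace.normalize ∘ (adjointEquiv T).symm ∘ gaussMap K ∘ T.symm)
      (frontier (T '' K)) := fun y hy => by
    conv_lhs => rw [← T.apply_symm_apply y]
    exact h.gaussMap_image hK (mapsTo_symm hy) T
  have gaussMap_comp : HasFDerivWithinAt (gaussMap K ∘ T.symm)
      (fderivWithin ℝ (gaussMap K) (frontier K) x ∘L T.symm) (frontier (T '' K)) (T x) :=
    HasFDerivWithinAt.comp (T x)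
      (by rw [T.symm_apply_apply]; exact h.hasFDerivWithinAt_gaussMap hK hx)
      T.symm.hasFDerivWithinAt mapsTo_symm
  have normalize_comp := (HasFDerivAt.comp_hasFDerivWithinAt (T x)
    (by
      simp only [Function.comp_apply, T.symm_apply_apply]
      exact hasFDerivAt_normalize (h.adjointEquiv_symm_gaussMap_ne_zero hK hx T))
    ((adjointEquiv T).symm.hasFDerivAt.comp_hasFDerivWithinAt (T x) gaussMap_comp)).congr
      eqOn (eqOn (frontier_image T K ▸ Set.mem_image_of_mem T hx))
  rw [h.norm_adjointEquiv_gaussMap_image hK hx T]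
  simpa only [h.gaussMap_image hK hx T, span_singleton_normalize] using normalize_comp

theorem gaussCurvature_image (h : HasC2Boundary K) (hK : Convex ℝ K) (hx : x ∈ frontier K)
    (T : E n ≃L[ℝ] E n) :
    gaussCurvature (T '' K) (T x) =
      ‖adjointEquiv T (gaussMap (T '' K) (T x))‖ ^ (n + 1) /
        LinearMap.det (T : E n →ₗ[ℝ] E n) ^ 2 * gaussCurvature K x := by
  have image_convex : Convex ℝ (T '' K) := hK.linear_image (T : E n →ₗ[ℝ] E n)
  have hTx : T x ∈ frontier (T '' K) := frontier_image T K ▸ Set.mem_image_of_mem T hx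
  have span_eq : ℝ ∙ adjointEquiv T (gaussMap (T '' K) (T x)) = ℝ ∙ gaussMap K x := by
    rw [h.adjointEquiv_gaussMap_image hK hx T]
    exact Submodule.span_singleton_smul_eq (inv_ne_zero (norm_ne_zero_iff.2
      (h.adjointEquiv_symm_gaussMap_ne_zero hK hx T))).isUnit _
  set u := gaussMap (T '' K) (T x)
  have norm_u : ‖u‖ = 1 := ((h.image T).isOuterUnitNormal_gaussMap image_convex hTx).2.1
  have u_ne_zero : u ≠ 0 := norm_ne_zero_iff.1 (norm_u ▸ one_ne_zero)
  have hn : n ≠ 0 := by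
    rintro rfl
    exact u_ne_zero (Subsingleton.elim _ _)
  have derivatives_eqOn := ((h.image T).hasFDerivWithinAt_gaussMap image_convex hTx).unique_on
    (h.hasFDerivWithinAt_gaussMap_image hK hx T)
  calc gaussCurvature (T '' K) (T x)
      = tangentDet u ((‖adjointEquiv T u‖ • (ℝ ∙ u)ᗮ.starProjection) ∘L
          (adjointEquiv T).symm ∘L fderivWithin ℝ (gaussMap K) (frontier K) x ∘L T.symm) :=
        tangentDet_congr (derivatives_eqOn.mono
          ((h.image T).orthogonal_gaussMap_subset_tangentConeAt image_convex hTx))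
    _ = ‖adjointEquiv T u‖ ^ (n - 1) * tangentDet u
          ((adjointEquiv T).symm ∘L fderivWithin ℝ (gaussMap K) (frontier K) x ∘L T.symm) := by
        rw [ContinuousLinearMap.smul_comp, tangentDet_smul u_ne_zero,
          tangentDet_starProjection_comp]
    _ = ‖adjointEquiv T u‖ ^ (n + 1) / LinearMap.det (T : E n →ₗ[ℝ] E n) ^ 2 *
          gaussCurvature K x := by
        rw [tangentDet_conj norm_u, tangentDet_eq_of_span_eq span_eq, gaussCurvature,
          show n + 1 = (n - 1) + 2 by omega, pow_add]
        ring

end HasC2Boundary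

theorem IsC2Plus.curvatureFun_image {K : ConvexBody (E n)} (hK : IsC2Plus K)
    (T : E n ≃L[ℝ] E n) {u : E n} (hu : ‖u‖ = 1) :
    curvatureFun (T '' (K : Set (E n))) u =
      LinearMap.det (T : E n →ₗ[ℝ] E n) ^ 2 / ‖adjointEquiv T u‖ ^ (n + 1) *
        curvatureFun (K : Set (E n)) (NormedSpace.normalize (adjointEquiv T u)) := by
  have hT0 : adjointEquiv T u ≠ 0 := (map_ne_zero_iff _ (adjointEquiv T).injective).2
    (norm_ne_zero_iff.1 (hu ▸ one_ne_zero))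
  have exists_normal : ∃ y, IsOuterUnitNormal (T '' (K : Set (E n))) y u := by
    obtain ⟨x, hx⟩ := exists_isOuterUnitNormal K (NormedSpace.norm_normalize hT0)
    exact ⟨T x, (isOuterUnitNormal_image_iff T _ x hu).2 hx⟩
  obtain ⟨x, hTx⟩ := T.surjective exists_normal.choose
  have image_normal : IsOuterUnitNormal (T '' (K : Set (E n))) (T x) u :=
    hTx ▸ exists_normal.choose_spec
  have normal := (isOuterUnitNormal_image_iff T _ x hu).1 image_normal
  have gaussMap_eq : gaussMap (T '' (K : Set (E n))) (T x) = u :=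
    (((hK.c2_boundary.image T).isOuterUnitNormal_iff
      (K.convex.linear_image (T : E n →ₗ[ℝ] E n)) image_normal.1).1 image_normal).symm
  rw [curvatureFun, dif_pos exists_normal, ← hTx, hK.curvatureFun_eq normal,
    hK.c2_boundary.gaussCurvature_image K.convex normal.1 T, gaussMap_eq, mul_inv, inv_div]

theorem supportFun_image (T : E n ≃L[ℝ] E n) (K : Set (E n)) (u : E n) :
    supportFun (T '' K) u = supportFun K (adjointEquiv T u) := by
  rw [supportFun, supportFun, Set.image_image]
  congr 1
  refine Set.image_congr fun x _ => ?_
  rw [real_inner_comm, ← inner_adjointEquiv_left, real_inner_comm]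

theorem supportFun_smul (K : Set (E n)) {c : ℝ} (hc : 0 ≤ c) (u : E n) :
    supportFun K (c • u) = c * supportFun K u := by
  simp only [supportFun, real_inner_smul_right, ← smul_eq_mul, ← Real.sSup_smul_of_nonneg hc,
    ← Set.image_smul, Set.image_image]

theorem supportFun_image_eq_norm_mul (T : E n ≃L[ℝ] E n) (K : Set (E n)) (u : E n) :
    supportFun (T '' K) u =
      ‖adjointEquiv T u‖ * supportFun K (NormedSpace.normalize (adjointEquiv T u)) := by
  rw [← supportFun_smul K (norm_nonneg _), NormedSpace.norm_smul_normalize, supportFun_image]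

theorem supportFun_nonneg {K : ConvexBody (E n)} (h0 : (0 : E n) ∈ K) (u : E n) :
    0 ≤ supportFun (K : Set (E n)) u := by
  have bddAbove : BddAbove ((fun x : E n => ⟪x, u⟫) '' K) :=
    (K.isCompact.image (by fun_prop)).bddAbove
  exact le_csSup bddAbove ⟨0, h0, inner_zero_left u⟩

theorem IsC2Plus.zero_mem {K : ConvexBody (E n)} (hK : IsC2Plus K)
    (hc : centroid (K : Set (E n)) = 0) : (0 : E n) ∈ K := by
  have volume_ne_zero : volume (K : Set (E n)) ≠ 0 :=
    (Measure.measure_pos_of_nonempty_interior volume hK.nonempty_interior).ne'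
  have average_mem : centroid (K : Set (E n)) ∈ (K : Set (E n)) :=
    K.convex.set_average_mem K.isClosed volume_ne_zero K.isCompact.measure_lt_top.ne
      (ae_restrict_mem K.isClosed.measurableSet)
      (continuousOn_id.integrableOn_compact K.isCompact)
  exact hc ▸ average_mem

end LinearImage

section SphereChangeOfVariables

variable {V : Type*} [NormedAddCommGroup V] [NormedSpace ℝ V]

theorem map_sphere_ne_zero (L : V ≃L[ℝ] V) (u : sphere (0 : V) 1) : L u ≠ 0 :=
  (map_ne_zero_iff _ L.injective).2 (ne_zero_of_mem_unit_sphere u)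

theorem continuous_normalize_map (L : V ≃L[ℝ] V) :
    Continuous fun u : sphere (0 : V) 1 => NormedSpace.normalize (L u) :=
  have continuous_map : Continuous fun u : sphere (0 : V) 1 => L u :=
    L.continuous.comp continuous_subtype_val
  (continuous_map.norm.inv₀ fun u => norm_ne_zero_iff.2 (map_sphere_ne_zero L u)).smul
    continuous_map

theorem normalize_symm_normalize_map (L : V ≃L[ℝ] V) (u : sphere (0 : V) 1) :
    NormedSpace.normalize (L.symm (NormedSpace.normalize (L u))) = u := by
  have h := normalize_map_normalize (L.symm : V →ₗ[ℝ] V) (L u)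
  simpa [NormedSpace.normalize_eq_self_of_norm_eq_one (mem_sphere_zero_iff_norm.1 u.2)] using h

/-- The homeomorphism `u ↦ L u / ‖L u‖` of the unit sphere induced by a linear automorphism `L`,
through which the substitution in the surface integrals is expressed. -/
def sphereHomeomorph (L : V ≃L[ℝ] V) : sphere (0 : V) 1 ≃ₜ sphere (0 : V) 1 where
  toFun u := ⟨NormedSpace.normalize (L u),
    mem_sphere_zero_iff_norm.2 (NormedSpace.norm_normalize (map_sphere_ne_zero L u))⟩
  invFun u := ⟨NormedSpace.normalize (L.symm u),
    mem_sphere_zero_iff_norm.2 (NormedSpace.norm_normalize (map_sphere_ne_zero L.symm u))⟩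
  left_inv u := Subtype.ext (normalize_symm_normalize_map L u)
  right_inv u := Subtype.ext (normalize_symm_normalize_map L.symm u)
  continuous_toFun := (continuous_normalize_map L).subtype_mk _
  continuous_invFun := (continuous_normalize_map L.symm).subtype_mk _

theorem coe_sphereHomeomorph (L : V ≃L[ℝ] V) (u : sphere (0 : V) 1) :
    (sphereHomeomorph L u : V) = NormedSpace.normalize (L u) := rfl

theorem sphereHomeomorph_homeomorphUnitSphereProd_fst (L : V ≃L[ℝ] V) {z : V} (hz : z ≠ 0)
    (hLz : L z ≠ 0) : sphereHomeomorph L (homeomorphUnitSphereProd V ⟨z, hz⟩).1 =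
      (homeomorphUnitSphereProd V ⟨L z, hLz⟩).1 :=
  Subtype.ext <| by
    rw [coe_sphereHomeomorph, homeomorphUnitSphereProd_apply_fst_coe,
      homeomorphUnitSphereProd_apply_fst_coe]
    exact normalize_map_normalize (L : V →ₗ[ℝ] V) z

/-- The punctured star-shaped set of the nonzero vectors with direction in `s` and norm less than
the value of the radial function `ρ` in that direction. Its volume turns a linear change of
variables in `V` into one on the sphere. -/
def radialSet (s : Set (sphere (0 : V) 1)) (ρ : sphere (0 : V) 1 → ℝ) : Set V :=
  {z | ∃ hz : z ≠ 0, (homeomorphUnitSphereProd V ⟨z, hz⟩).1 ∈ s ∧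
    ‖z‖ < ρ (homeomorphUnitSphereProd V ⟨z, hz⟩).1}

theorem preimage_radialSet_one (L : V ≃L[ℝ] V) (s : Set (sphere (0 : V) 1)) :
    L ⁻¹' radialSet s (fun _ => 1) = radialSet (sphereHomeomorph L ⁻¹' s) fun u => ‖L u‖⁻¹ := by
  ext z
  rcases eq_or_ne z 0 with rfl | hz
  · simp [radialSet]
  have hLz : L z ≠ 0 := (map_ne_zero_iff _ L.injective).2 hz
  have norm_lt_iff : ‖z‖ < ‖L (homeomorphUnitSphereProd V ⟨z, hz⟩).1‖⁻¹ ↔ ‖L z‖ < 1 := by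
    rw [homeomorphUnitSphereProd_apply_fst_coe, map_smul, norm_smul, norm_inv, norm_norm, mul_inv,
      inv_inv, lt_mul_iff_one_lt_right (norm_pos_iff.2 hz), one_lt_inv₀ (norm_pos_iff.2 hLz)]
  simp only [radialSet, Set.mem_preimage, Set.mem_ofPred_eq, exists_prop_of_true hz,
    exists_prop_of_true hLz, norm_lt_iff, sphereHomeomorph_homeomorphUnitSphereProd_fst L hz hLz]

variable [FiniteDimensional ℝ V] [MeasurableSpace V] [BorelSpace V]
  (μ : Measure V) [μ.IsAddHaarMeasure]

theorem measure_radialSet [Nontrivial V] {s : Set (sphere (0 : V) 1)} (hs : MeasurableSet s)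
    {ρ : sphere (0 : V) 1 → ℝ} (hρ : Measurable ρ) (ρ_pos : ∀ u, 0 < ρ u) :
    μ (radialSet s ρ) =
      ∫⁻ u in s, ENNReal.ofReal (ρ u ^ finrank ℝ V / finrank ℝ V) ∂μ.toSphere := by
  set P : Set (sphere (0 : V) 1 × Set.Ioi (0 : ℝ)) := {p | p.1 ∈ s ∧ (p.2 : ℝ) < ρ p.1} with hP
  have measurableSet_P : MeasurableSet P := (measurable_fst hs).inter
    (measurableSet_lt (measurable_subtype_coe.comp measurable_snd) (hρ.comp measurable_fst))
  have radialSet_eq : radialSet s ρ = (↑) '' (homeomorphUnitSphereProd V ⁻¹' P) := by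
    ext z
    simp [radialSet, hP]
  have section_measure (u : sphere (0 : V) 1) :
      Measure.volumeIoiPow (finrank ℝ V - 1) (Prod.mk u ⁻¹' P) =
        s.indicator (fun u => ENNReal.ofReal (ρ u ^ finrank ℝ V / finrank ℝ V)) u := by
    by_cases hu : u ∈ s
    · have section_eq : Prod.mk u ⁻¹' P = Set.Iio (⟨ρ u, ρ_pos u⟩ : Set.Ioi (0 : ℝ)) := by
        ext r
        simp [hP, hu, ← Subtype.coe_lt_coe]
      rw [section_eq, Measure.volumeIoiPow_apply_Iio, Set.indicator_of_mem hu,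
        ← Nat.cast_add_one, Nat.sub_add_cancel finrank_pos]
    · have section_eq : Prod.mk u ⁻¹' P = ∅ := by
        ext r
        simp [hP, hu]
      rw [section_eq, measure_empty, Set.indicator_of_notMem hu]
  rw [radialSet_eq, ← comap_subtype_coe_apply (measurableSet_singleton _).compl,
    μ.measurePreserving_homeomorphUnitSphereProd.measure_preimage
      measurableSet_P.nullMeasurableSet, Measure.prod_apply measurableSet_P,
    ← lintegral_indicator hs]
  exact lintegral_congr section_measure

theorem map_withDensity_sphereHomeomorph [Nontrivial V] (L : V ≃L[ℝ] V) :
    (μ.toSphere.withDensity fun u => ENNReal.ofReal (‖L u‖ ^ finrank ℝ V)⁻¹).map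
        (sphereHomeomorph L) =
      ENNReal.ofReal |LinearMap.det (L : V →ₗ[ℝ] V)|⁻¹ • μ.toSphere := by
  ext s hs
  have hs' := (sphereHomeomorph L).measurable hs
  have dim_pos : (0 : ℝ) < finrank ℝ V := by exact_mod_cast finrank_pos
  have ofReal_div (u : sphere (0 : V) 1) :
      ENNReal.ofReal (‖L u‖⁻¹ ^ finrank ℝ V / finrank ℝ V) =
        ENNReal.ofReal (‖L u‖ ^ finrank ℝ V)⁻¹ * ENNReal.ofReal (finrank ℝ V : ℝ)⁻¹ := by
    rw [div_eq_mul_inv, ENNReal.ofReal_mul (by positivity), inv_pow]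
  have measure_preimage := measure_radialSet μ hs' (ρ := fun u => ‖L u‖⁻¹) (by fun_prop)
    fun u => inv_pos.2 (norm_pos_iff.2 (map_sphere_ne_zero L u))
  rw [← preimage_radialSet_one, Measure.addHaar_preimage_continuousLinearEquiv,
    measure_radialSet μ hs measurable_const fun _ => one_pos] at measure_preimage
  simp only [ofReal_div] at measure_preimage
  rw [lintegral_mul_const _ (by fun_prop),
    setLIntegral_const, one_pow, one_div, mul_comm (ENNReal.ofReal (finrank ℝ V : ℝ)⁻¹),
    ← mul_assoc] at measure_preimage
  rw [Measure.map_apply (sphereHomeomorph L).measurable hs, withDensity_apply _ hs',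
    Measure.smul_apply, smul_eq_mul, ← abs_inv, ← LinearEquiv.det_coe_symm]
  exact ((ENNReal.mul_left_inj (ENNReal.ofReal_pos.2 (inv_pos.2 dim_pos)).ne'
    ENNReal.ofReal_ne_top).1 measure_preimage).symm

theorem integral_sphereHomeomorph {F : Type*} [NormedAddCommGroup F] [NormedSpace ℝ F]
    (L : V ≃L[ℝ] V) (g : sphere (0 : V) 1 → F) :
    ∫ u, (‖L u‖ ^ finrank ℝ V)⁻¹ • g (sphereHomeomorph L u) ∂μ.toSphere =
      |LinearMap.det (L : V →ₗ[ℝ] V)|⁻¹ • ∫ u, g u ∂μ.toSphere := by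
  rcases subsingleton_or_nontrivial V with _ | _
  · have : IsEmpty (sphere (0 : V) 1) := ⟨fun u =>
      ne_zero_of_mem_unit_sphere u (Subsingleton.elim _ _)⟩
    simp only [integral_of_isEmpty, smul_zero]
  calc ∫ u, (‖L u‖ ^ finrank ℝ V)⁻¹ • g (sphereHomeomorph L u) ∂μ.toSphere
      = ∫ u, g (sphereHomeomorph L u)
          ∂μ.toSphere.withDensity fun u => ENNReal.ofReal (‖L u‖ ^ finrank ℝ V)⁻¹ := by
        rw [integral_withDensity_eq_integral_toReal_smul
          (by fun_prop)
          (ae_of_all _ fun _ => ENNReal.ofReal_lt_top)]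
        simp only [ENNReal.toReal_ofReal (inv_nonneg.2 (pow_nonneg (norm_nonneg _) _))]
    _ = |LinearMap.det (L : V →ₗ[ℝ] V)|⁻¹ • ∫ u, g u ∂μ.toSphere := by
        rw [← (sphereHomeomorph L).measurableEmbedding.integral_map,
          map_withDensity_sphereHomeomorph, integral_smul_measure,
          ENNReal.toReal_ofReal (inv_nonneg.2 (abs_nonneg _))]

end SphereChangeOfVariables

section MixedAffineSurfaceArea

variable {n : ℕ}

theorem prod_mul_rpow_mul_div_pow_rpow {b d p : ℝ} (hb : 0 < b) (hd : 0 ≤ d)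
    (hnp : (n : ℝ) + p ≠ 0) {h f : Fin n → ℝ} (hh : ∀ i, 0 ≤ h i) (hf : ∀ i, 0 ≤ f i) :
    (∏ i, (b * h i) ^ (1 - p) * (d ^ 2 / b ^ (n + 1) * f i)) ^ (1 / ((n : ℝ) + p)) =
      d ^ (2 * (n : ℝ) / (n + p)) *
        ((b ^ n)⁻¹ * (∏ i, h i ^ (1 - p) * f i) ^ (1 / ((n : ℝ) + p))) := by
  have rpow_div_pow : b ^ (1 - p) / b ^ (n + 1) = b ^ (-((n : ℝ) + p)) := by
    rw [← Real.rpow_natCast, ← Real.rpow_sub hb]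
    congr 1
    push_cast
    ring
  have factor (i : Fin n) : (b * h i) ^ (1 - p) * (d ^ 2 / b ^ (n + 1) * f i) =
      d ^ 2 * b ^ (-((n : ℝ) + p)) * (h i ^ (1 - p) * f i) := by
    rw [Real.mul_rpow hb.le (hh i), ← rpow_div_pow]
    ring
  have prod_nonneg : 0 ≤ ∏ i, h i ^ (1 - p) * f i :=
    Finset.prod_nonneg fun i _ => mul_nonneg (Real.rpow_nonneg (hh i) _) (hf i)
  have det_factor : ((d ^ 2) ^ n) ^ (1 / ((n : ℝ) + p)) = d ^ (2 * (n : ℝ) / (n + p)) := by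
    rw [← pow_mul, ← Real.rpow_natCast_mul hd]
    congr 1
    push_cast
    ring
  have norm_factor : ((b ^ (-((n : ℝ) + p))) ^ n) ^ (1 / ((n : ℝ) + p)) = (b ^ n)⁻¹ := by
    rw [← Real.rpow_mul_natCast hb.le, ← Real.rpow_mul hb.le, ← Real.rpow_natCast,
      ← Real.rpow_neg hb.le]
    congr 1
    field_simp
  rw [Finset.prod_congr rfl fun i _ => factor i, Finset.prod_mul_distrib, Finset.prod_const,
    Finset.card_univ, Fintype.card_fin, mul_pow, Real.mul_rpow (by positivity) prod_nonneg,
    Real.mul_rpow (by positivity) (by positivity), det_factor, norm_factor, mul_assoc]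

theorem mixedAffineSurfaceArea_image {K : Fin n → ConvexBody (E n)} (hK : ∀ i, IsC2Plus (K i))
    (h0 : ∀ i, (0 : E n) ∈ K i) (T : E n ≃L[ℝ] E n) {p : ℝ} (hp : p ≠ -(n : ℝ)) :
    mixedAffineSurfaceArea p (fun i => T '' (K i : Set (E n))) =
      |LinearMap.det (T : E n →ₗ[ℝ] E n)| ^ (((n : ℝ) - p) / ((n : ℝ) + p)) *
        mixedAffineSurfaceArea p (fun i => (K i : Set (E n))) := by
  have hnp : (n : ℝ) + p ≠ 0 := fun h => hp (by linarith)
  set d := |LinearMap.det (T : E n →ₗ[ℝ] E n)| with hd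
  have d_pos : 0 < d := abs_pos.2 (LinearEquiv.isUnit_det' T.toLinearEquiv).ne_zero
  let g (u : sphere (0 : E n) 1) : ℝ :=
    (∏ i, supportFun (K i : Set (E n)) u ^ (1 - p) * curvatureFun (K i : Set (E n)) u) ^
      (1 / ((n : ℝ) + p))
  have integrand_eq (u : sphere (0 : E n) 1) :
      (∏ i, supportFun (T '' (K i : Set (E n))) u ^ (1 - p) *
        curvatureFun (T '' (K i : Set (E n))) u) ^ (1 / ((n : ℝ) + p)) =
      d ^ (2 * (n : ℝ) / ((n : ℝ) + p)) *
        ((‖adjointEquiv T u‖ ^ n)⁻¹ * g (sphereHomeomorph (adjointEquiv T) u)) := by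
    simp only [supportFun_image_eq_norm_mul,
      fun i => (hK i).curvatureFun_image T (mem_sphere_zero_iff_norm.1 u.2),
      ← sq_abs (LinearMap.det _), ← hd]
    exact prod_mul_rpow_mul_div_pow_rpow (norm_pos_iff.2 (map_sphere_ne_zero _ u)) d_pos.le hnp
      (fun i => supportFun_nonneg (h0 i) _) fun i => (hK i).curvatureFun_nonneg
        (mem_sphere_zero_iff_norm.1 (sphereHomeomorph (adjointEquiv T) u).2)
  have integral_eq := integral_sphereHomeomorph volume (adjointEquiv T) g
  rw [finrank_euclideanSpace_fin, det_adjointEquiv] at integral_eq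
  calc mixedAffineSurfaceArea p (fun i => T '' (K i : Set (E n)))
      = d ^ (2 * (n : ℝ) / ((n : ℝ) + p)) *
          (d⁻¹ * ∫ u, g u ∂(volume : Measure (E n)).toSphere) := by
        rw [mixedAffineSurfaceArea, integral_congr_ae (ae_of_all _ integrand_eq),
          integral_const_mul]
        exact congrArg _ integral_eq
    _ = d ^ (((n : ℝ) - p) / ((n : ℝ) + p)) *
          mixedAffineSurfaceArea p (fun i => (K i : Set (E n))) := by
        rw [← mul_assoc, ← Real.rpow_neg_one, ← Real.rpow_add d_pos, mixedAffineSurfaceArea]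
        congr 2
        field_simp
        ring

theorem mixedAffineSurfaceAreaInfty_image (K : Fin n → Set (E n)) (T : E n ≃L[ℝ] E n) :
    mixedAffineSurfaceAreaInfty (fun i => T '' K i) =
      |LinearMap.det (T : E n →ₗ[ℝ] E n)|⁻¹ * mixedAffineSurfaceAreaInfty K := by
  let g (u : sphere (0 : E n) 1) : ℝ := ∏ i, 1 / supportFun (K i) u
  have integrand_eq (u : sphere (0 : E n) 1) : ∏ i, 1 / supportFun (T '' K i) u =
      (‖adjointEquiv T u‖ ^ n)⁻¹ * g (sphereHomeomorph (adjointEquiv T) u) := by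
    simp only [g, coe_sphereHomeomorph, supportFun_image_eq_norm_mul, one_div, mul_inv,
      Finset.prod_mul_distrib, Finset.prod_const, Finset.card_univ, Fintype.card_fin, inv_pow]
  have integral_eq := integral_sphereHomeomorph volume (adjointEquiv T) g
  rw [finrank_euclideanSpace_fin, det_adjointEquiv] at integral_eq
  rw [mixedAffineSurfaceAreaInfty, integral_congr_ae (ae_of_all _ integrand_eq)]
  exact integral_eq

end MixedAffineSurfaceArea

end

end MixedAffine

theorem mainTheorem9_general {n : ℕ}
    {K : Fin n → ConvexBody (EuclideanSpace ℝ (Fin n))}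
    (hK : ∀ i, MixedAffine.IsC2Plus (K i))
    (h0 : ∀ i, (0 : EuclideanSpace ℝ (Fin n)) ∈ K i)
    (T : EuclideanSpace ℝ (Fin n) ≃ₗ[ℝ] EuclideanSpace ℝ (Fin n)) :
    (∀ p : ℝ, p ≠ -(n : ℝ) →
      MixedAffine.mixedAffineSurfaceArea p
          (fun i => T '' (K i : Set (EuclideanSpace ℝ (Fin n)))) =
        |LinearMap.det (T : EuclideanSpace ℝ (Fin n) →ₗ[ℝ] EuclideanSpace ℝ (Fin n))|
            ^ (((n : ℝ) - p) / ((n : ℝ) + p)) *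
          MixedAffine.mixedAffineSurfaceArea p
            (fun i => (K i : Set (EuclideanSpace ℝ (Fin n))))) ∧
    MixedAffine.mixedAffineSurfaceAreaInfty
        (fun i => T '' (K i : Set (EuclideanSpace ℝ (Fin n)))) =
      |LinearMap.det (T : EuclideanSpace ℝ (Fin n) →ₗ[ℝ] EuclideanSpace ℝ (Fin n))|⁻¹ *
        MixedAffine.mixedAffineSurfaceAreaInfty
          (fun i => (K i : Set (EuclideanSpace ℝ (Fin n)))) ∧
    (|LinearMap.det (T : EuclideanSpace ℝ (Fin n) →ₗ[ℝ] EuclideanSpace ℝ (Fin n))| = 1 →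
      (∀ p : ℝ, p ≠ -(n : ℝ) →
        MixedAffine.mixedAffineSurfaceArea p
            (fun i => T '' (K i : Set (EuclideanSpace ℝ (Fin n)))) =
          MixedAffine.mixedAffineSurfaceArea p
            (fun i => (K i : Set (EuclideanSpace ℝ (Fin n))))) ∧
      MixedAffine.mixedAffineSurfaceAreaInfty
          (fun i => T '' (K i : Set (EuclideanSpace ℝ (Fin n)))) =
        MixedAffine.mixedAffineSurfaceAreaInfty
          (fun i => (K i : Set (EuclideanSpace ℝ (Fin n))))) := by
  have area_image (p : ℝ) (hp : p ≠ -(n : ℝ)) :=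
    MixedAffine.mixedAffineSurfaceArea_image hK h0 T.toContinuousLinearEquiv hp
  have areaInfty_image := MixedAffine.mixedAffineSurfaceAreaInfty_image
    (fun i => (K i : Set (EuclideanSpace ℝ (Fin n)))) T.toContinuousLinearEquiv
  refine ⟨area_image, areaInfty_image, fun abs_det_eq_one => ⟨fun p hp => ?_, ?_⟩⟩
  · simpa [abs_det_eq_one] using area_image p hp
  · simpa [abs_det_eq_one] using areaInfty_image

theorem mainTheorem9 (n : ℕ) (hn : 1 ≤ n)
    (K : Fin n → ConvexBody (EuclideanSpace ℝ (Fin n)))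
    (hK : ∀ i, MixedAffine.IsC2Plus (K i))
    (hcent : ∀ i, MixedAffine.centroid (K i : Set (EuclideanSpace ℝ (Fin n))) = 0)
    (T : EuclideanSpace ℝ (Fin n) ≃ₗ[ℝ] EuclideanSpace ℝ (Fin n)) :
    (∀ p : ℝ, p ≠ -(n : ℝ) →
      MixedAffine.mixedAffineSurfaceArea p
          (fun i => T '' (K i : Set (EuclideanSpace ℝ (Fin n)))) =
        |LinearMap.det (T : EuclideanSpace ℝ (Fin n) →ₗ[ℝ] EuclideanSpace ℝ (Fin n))|
            ^ (((n : ℝ) - p) / ((n : ℝ) + p)) *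
          MixedAffine.mixedAffineSurfaceArea p
            (fun i => (K i : Set (EuclideanSpace ℝ (Fin n))))) ∧
    MixedAffine.mixedAffineSurfaceAreaInfty
        (fun i => T '' (K i : Set (EuclideanSpace ℝ (Fin n)))) =
      |LinearMap.det (T : EuclideanSpace ℝ (Fin n) →ₗ[ℝ] EuclideanSpace ℝ (Fin n))|⁻¹ *
        MixedAffine.mixedAffineSurfaceAreaInfty
          (fun i => (K i : Set (EuclideanSpace ℝ (Fin n)))) ∧
    (|LinearMap.det (T : EuclideanSpace ℝ (Fin n) →ₗ[ℝ] EuclideanSpace ℝ (Fin n))| = 1 →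
      (∀ p : ℝ, p ≠ -(n : ℝ) →
        MixedAffine.mixedAffineSurfaceArea p
            (fun i => T '' (K i : Set (EuclideanSpace ℝ (Fin n)))) =
          MixedAffine.mixedAffineSurfaceArea p
            (fun i => (K i : Set (EuclideanSpace ℝ (Fin n))))) ∧
      MixedAffine.mixedAffineSurfaceAreaInfty
          (fun i => T '' (K i : Set (EuclideanSpace ℝ (Fin n)))) =
        MixedAffine.mixedAffineSurfaceAreaInfty
          (fun i => (K i : Set (EuclideanSpace ℝ (Fin n))))) :=
  mainTheorem9_general hK (fun i => (hK i).zero_mem (hcent i)) T
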